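/- Let $d\in\mathbb{N}$ and write points of $\mathbb{R}^{2d}=\mathbb{R}^d\times\mathbb{R}^d$ as $(x,v)$. Let $\mathcal{P}_2(\mathbb{R}^{2d})$ be the set of Borel probability measures $\mu$ on $\mathbb{R}^{2d}$ with $\int (|x|^2+|v|^2)\,d\mu<\infty$, endowed with the narrow topology (convergence against bounded continuous functions). For $\mu\in\mathcal{P}_2(\mathbb{R}^{2d})$ let $\Pi^x\mu$ denote its $x$-marginal, i.e. its push-forward under $(x,v)\mapsto x$, and let $(\mu^x)_{x\in\mathbb{R}^d}$ be the disintegration of $\mu$ with respect to $\Pi^x\mu$, i.e. the $\Pi^x\mu$-a.e. uniquely determined Borel family of probability measures on $\mathbb{R}^d$ with $\int\!\int f(x,v)\,d\mu^x(v)\,d\Pi^x\mu(x)=\int f\,d\mu$ for all Borel $f:\mathbb{R}^{2d}\to[0,+\infty]$. Let $W_2$ be the $2$-Wasserstein distance on $\mathbb{R}^d$, $$W_2(\rho,\eta)=\inf_{\gamma\in\Gamma(\rho,\eta)}\left(\int_{\mathbb{R}^d\times\mathbb{R}^d}|v-w|^2\,d\gamma(v,w)\right)^{1/2},$$ where $\Gamma(\rho,\eta)$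 is the set of probability measures on $\mathbb{R}^d\times\mathbb{R}^d$ with first marginal $\rho$ and second marginal $\eta$. The fibered Wasserstein distance (Wasserstein distance with fixed $x$-marginals) of $\mu,\nu\in\mathcal{P}_2(\mathbb{R}^{2d})$ is $$W_{2,v}(\mu,\nu)=\begin{cases}\left(\int_{\mathbb{R}^d}W_2^2(\mu^x,\nu^x)\,d\Pi^x\mu(x)\right)^{1/2} & \text{if }\Pi^x\mu=\Pi^x\nu,\\ +\infty&\text{otherwise.}\end{cases}$$ **Proposition.** The map $(\mu,\nu)\mapsto W_{2,v}(\mu,\nu)$ from $\mathcal{P}_2(\mathbb{R}^{2d})\times\mathcal{P}_2(\mathbb{R}^{2d})$ to $[0,+\infty]$ is (jointly) lower semicontinuous with respect to the narrow topology. In particular, if $\mu_n\to\mu$ and $\nu_n\to\nu$ narrowly in $\mathcal{P}_2(\mathbb{R}^{2d})$, then $W_{2,v}(\mu,\nu)\le\liminf_{n\to\infty}W_{2,v}(\mu_n,\nu_n)$. -/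

import Mathlib

open MeasureTheory
open scoped ENNReal

noncomputable section

/-- The set `Γ(μ, ν)` of transport plans: measures on the product with marginals `μ` and `ν`. -/
def transportPlans {X : Type*} [MeasurableSpace X] (μ ν : Measure X) : Set (Measure (X × X)) :=
  {γ | γ.fst = μ ∧ γ.snd = ν}

/-- The `2`-Wasserstein distance on `ℝ^d`, with values in `[0, ∞]`. -/
def W2 {d : ℕ} (μ ν : Measure (EuclideanSpace ℝ (Fin d))) : ℝ≥0∞ :=
  (⨅ γ ∈ transportPlans μ ν, ∫⁻ p, ‖p.1 - p.2‖ₑ ^ 2 ∂γ) ^ (1 / 2 : ℝ)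

/-- Borel probability measures on `ℝ^{2d} = ℝ^d_x × ℝ^d_v` with finite second moment
(`|(x, v)|² = |x|² + |v|²`). As a subtype of `ProbabilityMeasure` it carries the narrow topology
(duality with bounded continuous functions). -/
abbrev P2 (d : ℕ) : Type :=
  {μ : ProbabilityMeasure (EuclideanSpace ℝ (Fin d) × EuclideanSpace ℝ (Fin d)) //
    ∫⁻ z : EuclideanSpace ℝ (Fin d) × EuclideanSpace ℝ (Fin d), (‖z.1‖ₑ ^ 2 + ‖z.2‖ₑ ^ 2)
      ∂(μ : Measure (EuclideanSpace ℝ (Fin d) × EuclideanSpace ℝ (Fin d))) < ∞}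

/-- The underlying measure on `ℝ^d × ℝ^d`. -/
abbrev P2.toMeasure {d : ℕ} (μ : P2 d) :
    Measure (EuclideanSpace ℝ (Fin d) × EuclideanSpace ℝ (Fin d)) :=
  (μ.1 : Measure (EuclideanSpace ℝ (Fin d) × EuclideanSpace ℝ (Fin d)))

/-- The `x`-marginal `Π^x μ`. -/
def P2.xMarginal {d : ℕ} (μ : P2 d) : Measure (EuclideanSpace ℝ (Fin d)) :=
  μ.toMeasure.fst

/-- The disintegration `μ^x` of `μ` with respect to its `x`-marginal. -/
def P2.disintegration {d : ℕ} (μ : P2 d) (x : EuclideanSpace ℝ (Fin d)) :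
    Measure (EuclideanSpace ℝ (Fin d)) :=
  μ.toMeasure.condKernel x

open Classical in
/-- The Wasserstein distance with fixed `x`-marginals (fibered Wasserstein distance):
`(∫ W₂²(μ^x, ν^x) d(Π^x μ)(x))^{1/2}` if `Π^x μ = Π^x ν`, and `+∞` otherwise. -/
def W2v {d : ℕ} (μ ν : P2 d) : ℝ≥0∞ :=
  if μ.xMarginal = ν.xMarginal then
    (∫⁻ x, W2 (μ.disintegration x) (ν.disintegration x) ^ 2 ∂μ.xMarginal) ^ (1 / 2 : ℝ)
  else ∞

end

/-!
The square of the fibered Wasserstein distance is an optimal transport problem over *fibered plans*: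
measures `γ` on `X × V × V` whose `(x, v)`-marginal is `μ` and whose `(x, w)`-marginal is `ν`, with
cost `|v - w|²`. In this form lower semicontinuity is the direct method: take near-optimal fibered
plans along a convergent sequence, extract a narrow limit, and compare costs.

The narrow topology is metrizable, so sequences suffice. A narrowly convergent sequence is tight,
hence so are plans between the terms of two such sequences, and by Prokhorov's theorem a subsequence
converges to a plan between the limits (`exists_subseq_tendsto_mem_fiberedPlans`). The marginal
condition passes to the limit, so equality of the `x`-marginals does too.

The two problems are linked by two inequalities. Disintegrating a fibered plan in `x` gives plans
between the fibres, so its cost is at least `W2v ^ 2` (`lintegral_iInf_transportPlans_le`).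
Conversely, nearly optimal plans between the fibres must be chosen measurably in `x`
(`exists_mem_fiberedPlans_lintegral_le`). No general selection theorem is used. Cut `V` into
countably many small cells. Inside any plan between `ρ` and `η` there is a sub-plan of almost full
mass whose density with respect to `ρ ⊗ η` is constant on products of cells, rational, and finitely
supported (`exists_blockWeight_le`); only countably many such densities exist. Adding the normalised
product of the two missing marginals turns a sub-plan into a plan at small expense if the cost is
bounded (`completedDensity`). So a countable family of kernels contains near-optimal plans in every
fibre, and the first good index is a measurable function of `x` (`exists_kernel_selection`).

Boundedness of the cost is harmless: the plans along the sequence are chosen near-optimal for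
`min(|v - w|, n)²` with `n → ∞`. Each truncated cost is bounded and continuous, hence passes to the
narrow limit, and monotone convergence recovers the quadratic cost of the limit plan.
-/

open ProbabilityTheory Filter Topology
open scoped NNReal

/-! ### Completing a sub-coupling density -/

section Completion

variable {V : Type*} [MeasurableSpace V]

lemma withDensity_prod_mem_transportPlans {ρ η : Measure V} [SFinite ρ] [SFinite η]
    {D : V × V → ℝ≥0∞} (hD : Measurable D)
    (h₁ : ∀ᵐ v ∂ρ, ∫⁻ w, D (v, w) ∂η = 1) (h₂ : ∀ᵐ w ∂η, ∫⁻ v, D (v, w) ∂ρ = 1) :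
    (ρ.prod η).withDensity D ∈ transportPlans ρ η := by
  constructor
  · ext s hs
    rw [Measure.fst_apply hs, withDensity_apply _ (measurable_fst hs), ← Set.prod_univ,
      ← Measure.prod_restrict, lintegral_prod _ hD.aemeasurable, Measure.restrict_univ,
      lintegral_congr_ae (ae_restrict_of_ae h₁)]
    simp
  · ext s hs
    rw [Measure.snd_apply hs, withDensity_apply _ (measurable_snd hs), ← Set.univ_prod,
      ← Measure.prod_restrict, lintegral_prod_symm _ hD.aemeasurable, Measure.restrict_univ,
      lintegral_congr_ae (ae_restrict_of_ae h₂)]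
    simp

/-- A density `a` with respect to `ρ ⊗ η` whose marginals are at most `ρ` and `η`, completed by the
normalised product of the two defects so that the marginals become exactly `ρ` and `η`. When `a` has
no defect the normalising factor is `∞`, but the defects then vanish almost everywhere. -/
noncomputable def completedDensity (ρ η : Measure V) (a : V × V → ℝ≥0∞) (p : V × V) : ℝ≥0∞ :=
  a p + (1 - ∫⁻ w, a (p.1, w) ∂η) * (1 - ∫⁻ v, a (v, p.2) ∂ρ) *
    (1 - ∫⁻ q, a q ∂(ρ.prod η))⁻¹

variable {ρ η : Measure V} [IsProbabilityMeasure ρ] [IsProbabilityMeasure η] {a : V × V → ℝ≥0∞}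

lemma measurable_completedDensity (ha : Measurable a) : Measurable (completedDensity ρ η a) := by
  unfold completedDensity
  have h₁ : Measurable fun v => ∫⁻ w, a (v, w) ∂η := ha.lintegral_prod_right'
  have h₂ : Measurable fun w => ∫⁻ v, a (v, w) ∂ρ := ha.lintegral_prod_left'
  fun_prop

lemma lintegral_one_sub_fst (ha : Measurable a) (h₁ : ∀ v, ∫⁻ w, a (v, w) ∂η ≤ 1) :
    ∫⁻ v, (1 - ∫⁻ w, a (v, w) ∂η) ∂ρ = 1 - ∫⁻ q, a q ∂(ρ.prod η) := by
  have hm : Measurable fun v => ∫⁻ w, a (v, w) ∂η := ha.lintegral_prod_right'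
  rw [lintegral_sub hm _ (ae_of_all _ h₁), lintegral_prod _ ha.aemeasurable]
  · simp
  · exact ((lintegral_mono h₁).trans_lt (by simp)).ne

lemma lintegral_one_sub_snd (ha : Measurable a) (h₂ : ∀ w, ∫⁻ v, a (v, w) ∂ρ ≤ 1) :
    ∫⁻ w, (1 - ∫⁻ v, a (v, w) ∂ρ) ∂η = 1 - ∫⁻ q, a q ∂(ρ.prod η) := by
  have hm : Measurable fun w => ∫⁻ v, a (v, w) ∂ρ := ha.lintegral_prod_left'
  rw [lintegral_sub hm _ (ae_of_all _ h₂), lintegral_prod_symm _ ha.aemeasurable]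
  · simp
  · exact ((lintegral_mono h₂).trans_lt (by simp)).ne

/-- The arithmetic behind `completedDensity`: along a fibre with mass `b ≤ 1`, the completion adds
the missing mass. -/
lemma add_defect_eq_one {b m : ℝ≥0∞} (hb : b ≤ 1) (hm : m ≤ 1) (h : m = 0 → 1 - b = 0) :
    b + (1 - b) * m * m⁻¹ = 1 := by
  rcases eq_or_ne m 0 with h0 | h0
  · have := tsub_eq_zero_iff_le.1 (h h0)
    simp [h0, le_antisymm hb this]
  · rw [mul_assoc, ENNReal.mul_inv_cancel h0 (hm.trans_lt ENNReal.one_lt_top).ne, mul_one,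
      add_tsub_cancel_of_le hb]

lemma withDensity_completedDensity_mem_transportPlans (ha : Measurable a)
    (h₁ : ∀ v, ∫⁻ w, a (v, w) ∂η ≤ 1) (h₂ : ∀ w, ∫⁻ v, a (v, w) ∂ρ ≤ 1) :
    (ρ.prod η).withDensity (completedDensity ρ η a) ∈ transportPlans ρ η := by
  have m₁ : Measurable fun v => ∫⁻ w, a (v, w) ∂η := ha.lintegral_prod_right'
  have m₂ : Measurable fun w => ∫⁻ v, a (v, w) ∂ρ := ha.lintegral_prod_left'
  have i₁ := lintegral_one_sub_fst (ρ := ρ) ha h₁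
  have i₂ := lintegral_one_sub_snd (η := η) ha h₂
  refine withDensity_prod_mem_transportPlans (measurable_completedDensity ha) ?_ ?_
  · have hz : (1 - ∫⁻ q, a q ∂(ρ.prod η) = 0) → ∀ᵐ v ∂ρ, 1 - ∫⁻ w, a (v, w) ∂η = 0 := fun h => by
      rw [← i₁, lintegral_eq_zero_iff (by fun_prop)] at h
      exact h
    filter_upwards [eventually_imp_distrib_left.2 hz] with v hv
    simp only [completedDensity]
    rw [lintegral_add_left (by fun_prop), lintegral_mul_const _ (by fun_prop),
      lintegral_const_mul _ (by fun_prop), i₂]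
    exact add_defect_eq_one (h₁ v) tsub_le_self hv
  · have hz : (1 - ∫⁻ q, a q ∂(ρ.prod η) = 0) → ∀ᵐ w ∂η, 1 - ∫⁻ v, a (v, w) ∂ρ = 0 := fun h => by
      rw [← i₂, lintegral_eq_zero_iff (by fun_prop)] at h
      exact h
    filter_upwards [eventually_imp_distrib_left.2 hz] with w hw
    simp only [completedDensity]
    rw [lintegral_add_left (by fun_prop), lintegral_mul_const _ (by fun_prop),
      lintegral_mul_const _ (by fun_prop), i₁, mul_comm (1 - ∫⁻ q, a q ∂(ρ.prod η))]
    exact add_defect_eq_one (h₂ w) tsub_le_self hw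

lemma lintegral_withDensity_completedDensity_le (ha : Measurable a)
    (h₁ : ∀ v, ∫⁻ w, a (v, w) ∂η ≤ 1) (h₂ : ∀ w, ∫⁻ v, a (v, w) ∂ρ ≤ 1)
    {c : V × V → ℝ≥0∞} (hc : Measurable c) {M : ℝ≥0∞} (hM : ∀ p, c p ≤ M) :
    ∫⁻ p, c p ∂((ρ.prod η).withDensity (completedDensity ρ η a)) ≤
      ∫⁻ p, c p * a p ∂(ρ.prod η) + M * (1 - ∫⁻ q, a q ∂(ρ.prod η)) := by
  have m₁ : Measurable fun v => ∫⁻ w, a (v, w) ∂η := ha.lintegral_prod_right'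
  have m₂ : Measurable fun w => ∫⁻ v, a (v, w) ∂ρ := ha.lintegral_prod_left'
  set m := 1 - ∫⁻ q, a q ∂(ρ.prod η) with hm
  have key : ∫⁻ p : V × V, (1 - ∫⁻ w, a (p.1, w) ∂η) * (1 - ∫⁻ v, a (v, p.2) ∂ρ) ∂(ρ.prod η)
      = m * m := by
    rw [lintegral_prod_mul (f := fun v => 1 - ∫⁻ w, a (v, w) ∂η)
      (g := fun w => 1 - ∫⁻ v, a (v, w) ∂ρ) (by fun_prop) (by fun_prop),
      lintegral_one_sub_fst ha h₁, lintegral_one_sub_snd ha h₂]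
  rw [lintegral_withDensity_eq_lintegral_mul _ (measurable_completedDensity ha) hc]
  calc ∫⁻ p, completedDensity ρ η a p * c p ∂(ρ.prod η)
      ≤ ∫⁻ p, (c p * a p + M * ((1 - ∫⁻ w, a (p.1, w) ∂η) * (1 - ∫⁻ v, a (v, p.2) ∂ρ) * m⁻¹))
          ∂(ρ.prod η) := by
        refine lintegral_mono fun p => ?_
        rw [completedDensity, add_mul, mul_comm (a p), ← hm, mul_comm _ (c p)]
        gcongr
        exact hM p
    _ = ∫⁻ p, c p * a p ∂(ρ.prod η) + M * (m * m * m⁻¹) := by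
        rw [lintegral_add_left (by fun_prop), lintegral_const_mul _ (by fun_prop),
          lintegral_mul_const _ (by fun_prop), key]
    _ ≤ _ := by
        gcongr
        rw [mul_assoc]
        exact mul_le_of_le_one_right' (ENNReal.mul_inv_le_one m)

end Completion

/-! ### Rational block approximation of a plan -/

/-- Index set for a countable family of finitely supported rational weights on `ℕ × ℕ`:
numerators and a common denominator. -/
abbrev BlockIndex : Type := ((ℕ × ℕ) →₀ ℕ) × ℕ

/-- The weight with numerators `k.1` and common denominator `k.2`. -/
noncomputable def blockWeight (k : BlockIndex) (i : ℕ × ℕ) : ℝ≥0∞ :=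
  ENNReal.ofReal ((k.1 i : ℝ) / k.2)

section Discrete

variable {r s : Measure ℕ} {g : Measure (ℕ × ℕ)}

/-- The density of a measure on `ℕ × ℕ` with respect to `r ⊗ s`, as a quotient of point masses.
Because `0 / 0 = 0`, it vanishes at points that `r ⊗ s` does not charge. -/
noncomputable def pointDensity (r s : Measure ℕ) (g : Measure (ℕ × ℕ)) (i : ℕ × ℕ) : ℝ≥0∞ :=
  g {i} / (r {i.1} * s {i.2})

lemma measure_singleton_le_of_mem_transportPlans (hg : g ∈ transportPlans r s) (i : ℕ × ℕ) :
    g {i} ≤ r {i.1} ∧ g {i} ≤ s {i.2} := by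
  constructor
  · rw [← hg.1, Measure.fst_apply (measurableSet_singleton _)]
    exact measure_mono (by simp)
  · rw [← hg.2, Measure.snd_apply (measurableSet_singleton _)]
    exact measure_mono (by simp)

variable [IsProbabilityMeasure r]

lemma pointDensity_ne_top (hg : g ∈ transportPlans r s) (i : ℕ × ℕ) :
    pointDensity r s g i ≠ ∞ := by
  obtain ⟨h₁, h₂⟩ := measure_singleton_le_of_mem_transportPlans hg i
  intro h
  rcases ENNReal.div_eq_top.1 h with ⟨h0, h⟩ | ⟨h, -⟩
  · rcases mul_eq_zero.1 h with h | h
    · exact h0 (le_zero_iff.1 (h ▸ h₁))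
    · exact h0 (le_zero_iff.1 (h ▸ h₂))
  · exact (h₁.trans_lt (measure_lt_top _ _)).ne h

variable [IsProbabilityMeasure s]

lemma pointDensity_mul (hg : g ∈ transportPlans r s) (i : ℕ × ℕ) :
    pointDensity r s g i * (r {i.1} * s {i.2}) = g {i} := by
  obtain ⟨h₁, h₂⟩ := measure_singleton_le_of_mem_transportPlans hg i
  refine ENNReal.div_mul_cancel' (fun h => ?_) fun h => ?_
  · rcases mul_eq_zero.1 h with h | h
    · exact le_zero_iff.1 (h ▸ h₁)
    · exact le_zero_iff.1 (h ▸ h₂)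
  · exact absurd h (ENNReal.mul_ne_top (measure_ne_top _ _) (measure_ne_top _ _))

lemma withDensity_pointDensity (hg : g ∈ transportPlans r s) :
    (r.prod s).withDensity (pointDensity r s g) = g := by
  refine Measure.ext_of_singleton fun i => ?_
  rw [withDensity_apply _ (measurableSet_singleton _), lintegral_singleton]
  rw [← pointDensity_mul hg i, ← Measure.prod_prod, Set.singleton_prod_singleton]

lemma lintegral_pointDensity_fst_le (hg : g ∈ transportPlans r s) (i : ℕ) :
    ∫⁻ j, pointDensity r s g (i, j) ∂s ≤ 1 := by
  rcases eq_or_ne (r {i}) 0 with h0 | h0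
  · have h : ∀ j, pointDensity r s g (i, j) = 0 := fun j => by
      have := (measure_singleton_le_of_mem_transportPlans hg (i, j)).1
      rw [pointDensity, le_zero_iff.1 (this.trans h0.le), ENNReal.zero_div]
    simp [h]
  · have h : (∫⁻ j, pointDensity r s g (i, j) ∂s) * r {i} = r {i} := by
      conv_rhs => rw [← hg.1, Measure.fst_apply (measurableSet_singleton _),
        ← withDensity_pointDensity hg,
        withDensity_apply _ (measurable_fst (measurableSet_singleton _)),
        ← Set.prod_univ, ← Measure.prod_restrict, lintegral_prod _ (by fun_prop),
        Measure.restrict_univ, lintegral_singleton]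
    exact ((ENNReal.mul_eq_right h0 (measure_ne_top _ _)).1 h).le

lemma lintegral_pointDensity_snd_le (hg : g ∈ transportPlans r s) (j : ℕ) :
    ∫⁻ i, pointDensity r s g (i, j) ∂r ≤ 1 := by
  rcases eq_or_ne (s {j}) 0 with h0 | h0
  · have h : ∀ i, pointDensity r s g (i, j) = 0 := fun i => by
      have := (measure_singleton_le_of_mem_transportPlans hg (i, j)).2
      rw [pointDensity, le_zero_iff.1 (this.trans h0.le), ENNReal.zero_div]
    simp [h]
  · have h : (∫⁻ i, pointDensity r s g (i, j) ∂r) * s {j} = s {j} := by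
      conv_rhs => rw [← hg.2, Measure.snd_apply (measurableSet_singleton _),
        ← withDensity_pointDensity hg,
        withDensity_apply _ (measurable_snd (measurableSet_singleton _)),
        ← Set.univ_prod, ← Measure.prod_restrict, lintegral_prod_symm _ (by fun_prop),
        Measure.restrict_univ, lintegral_singleton]
    exact ((ENNReal.mul_eq_right h0 (measure_ne_top _ _)).1 h).le

/-- Rounding a density down to multiples of `1 / N` and cutting it off outside `[0, N)²`
approximates it from below. -/
lemma exists_blockWeight_tendsto (d : ℕ × ℕ → ℝ≥0∞) (hd : ∀ i, d i ≠ ∞) :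
    ∃ k : ℕ → BlockIndex, (∀ N i, blockWeight (k N) i ≤ d i) ∧
      ∀ i, Tendsto (fun N => blockWeight (k N) i) atTop (𝓝 (d i)) := by
  classical
  refine ⟨fun N => (Finsupp.onFinset (Finset.range N ×ˢ Finset.range N)
    (fun i => if i ∈ Finset.range N ×ˢ Finset.range N then ⌊(d i).toReal * N⌋₊ else 0)
    (fun i h => by by_contra h'; simp [h'] at h), N), fun N i => ?_, fun i => ?_⟩
  · simp only [blockWeight, Finsupp.onFinset_apply]
    refine ENNReal.ofReal_le_of_le_toReal ?_
    split_ifs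
    · exact div_le_of_le_mul₀ (by positivity) (by positivity) (Nat.floor_le (by positivity))
    · simp
  · have h := ENNReal.tendsto_ofReal
      ((tendsto_nat_floor_mul_div_atTop (R := ℝ) (d i).toReal_nonneg).comp
        tendsto_natCast_atTop_atTop)
    rw [ENNReal.ofReal_toReal (hd i)] at h
    refine h.congr' ?_
    filter_upwards [eventually_gt_atTop (max i.1 i.2)] with N hN
    have : i ∈ Finset.range N ×ˢ Finset.range N := by
      simp only [Finset.mem_product, Finset.mem_range]; omega
    simp only [blockWeight, Finsupp.onFinset_apply, if_pos this, Function.comp_apply]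

/-- Every plan on `ℕ × ℕ` contains a sub-plan of almost full mass, with density in the countable
family `blockWeight`. -/
lemma exists_blockWeight_le (hg : g ∈ transportPlans r s) {ε : ℝ≥0∞} (hε : ε ≠ 0) :
    ∃ k : BlockIndex, (∀ i, ∫⁻ j, blockWeight k (i, j) ∂s ≤ 1) ∧
      (∀ j, ∫⁻ i, blockWeight k (i, j) ∂r ≤ 1) ∧
      1 - ∫⁻ i, blockWeight k i ∂(r.prod s) ≤ ε ∧
      ∀ f : ℕ × ℕ → ℝ≥0∞, ∫⁻ i, f i * blockWeight k i ∂(r.prod s) ≤ ∫⁻ i, f i ∂g := by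
  have hone : ∫⁻ i, pointDensity r s g i ∂(r.prod s) = 1 := by
    rw [← setLIntegral_univ, ← withDensity_apply _ MeasurableSet.univ, withDensity_pointDensity hg,
      ← Measure.fst_univ, hg.1, measure_univ]
  obtain ⟨k, hk, hlim⟩ := exists_blockWeight_tendsto _ (pointDensity_ne_top hg)
  have h := tendsto_lintegral_of_dominated_convergence (μ := r.prod s) (pointDensity r s g)
    (F := fun N => blockWeight (k N)) (fun N => measurable_of_countable _)
    (fun N => ae_of_all _ (hk N)) (by simp [hone]) (ae_of_all _ hlim)
  rw [hone] at h
  have h' : Tendsto (fun N => 1 - ∫⁻ i, blockWeight (k N) i ∂(r.prod s)) atTop (𝓝 (1 - 1)) :=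
    ENNReal.Tendsto.sub tendsto_const_nhds h (by simp)
  rw [tsub_self] at h'
  obtain ⟨N, hN⟩ := (h'.eventually (ge_mem_nhds (pos_iff_ne_zero.2 hε))).exists
  refine ⟨k N, fun i => (lintegral_mono fun j => hk N _).trans (lintegral_pointDensity_fst_le hg i),
    fun j => (lintegral_mono fun i => hk N _).trans (lintegral_pointDensity_snd_le hg j), hN,
    fun f => ?_⟩
  conv_rhs => rw [← withDensity_pointDensity hg,
    lintegral_withDensity_eq_lintegral_mul _ (measurable_of_countable _)
      (measurable_of_countable _)]
  refine lintegral_mono fun i => ?_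
  rw [Pi.mul_apply, mul_comm]
  gcongr
  exact hk N i

end Discrete

/-! ### Near-optimal plans from a countable family -/

section Fibre

variable {V : Type*} [MeasurableSpace V]

/-- The block weight `k` pulled back to `V × V` along the labelling `idx` of the cells of `V`. -/
noncomputable def cellDensity (idx : V → ℕ) (k : BlockIndex) (p : V × V) : ℝ≥0∞ :=
  blockWeight k (Prod.map idx idx p)

/-- The weight `k` defines a sub-plan of `(ρ, η)`: its marginals are dominated. -/
def IsFeasible (idx : V → ℕ) (k : BlockIndex) (ρ η : Measure V) : Prop :=
  (∀ i, ∫⁻ w, blockWeight k (i, idx w) ∂η ≤ 1) ∧ ∀ j, ∫⁻ v, blockWeight k (idx v, j) ∂ρ ≤ 1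

lemma measurable_cellDensity {idx : V → ℕ} (hidx : Measurable idx) (k : BlockIndex) :
    Measurable (cellDensity idx k) :=
  (measurable_of_countable (blockWeight k)).comp (hidx.prodMap hidx)

/-- For a bounded cost `c` that oscillates by at most `δ` on products of cells, the completed
feasible block densities contain a nearly optimal plan. -/
lemma exists_isFeasible_lintegral_le {idx : V → ℕ} (hidx : Measurable idx)
    {c : V × V → ℝ≥0∞} (hc : Measurable c) {M : ℝ≥0∞} (hM : ∀ p, c p ≤ M) {δ : ℝ≥0∞}
    (hδ : ∀ p q, Prod.map idx idx p = Prod.map idx idx q → c p ≤ c q + δ)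
    {ρ η : Measure V} [IsProbabilityMeasure ρ] [IsProbabilityMeasure η] {γ : Measure (V × V)}
    (hγ : γ ∈ transportPlans ρ η) {ε : ℝ≥0∞} (hε : ε ≠ 0) :
    ∃ k, IsFeasible idx k ρ η ∧
      ∫⁻ p, c p ∂((ρ.prod η).withDensity (completedDensity ρ η (cellDensity idx k))) ≤
        ∫⁻ p, c p ∂γ + δ + M * ε := by
  have hidx2 : Measurable (Prod.map idx idx) := hidx.prodMap hidx
  have : IsProbabilityMeasure (ρ.map idx) := Measure.isProbabilityMeasure_map hidx.aemeasurable
  have : IsProbabilityMeasure (η.map idx) := Measure.isProbabilityMeasure_map hidx.aemeasurable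
  have hγ1 : γ Set.univ = 1 := by rw [← Measure.fst_univ, hγ.1, measure_univ]
  have hg : γ.map (Prod.map idx idx) ∈ transportPlans (ρ.map idx) (η.map idx) := by
    constructor
    · rw [Measure.fst, Measure.map_map measurable_fst hidx2, ← hγ.1, Measure.fst,
        Measure.map_map hidx measurable_fst]
      rfl
    · rw [Measure.snd, Measure.map_map measurable_snd hidx2, ← hγ.2, Measure.snd,
        Measure.map_map hidx measurable_snd]
      rfl
  obtain ⟨k, h₁, h₂, h₃, h₄⟩ := exists_blockWeight_le hg hε
  have hprod : (ρ.map idx).prod (η.map idx) = (ρ.prod η).map (Prod.map idx idx) :=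
    Measure.map_prod_map _ _ hidx hidx
  have h₁' : ∀ i, ∫⁻ w, blockWeight k (i, idx w) ∂η ≤ 1 := fun i => by
    rw [← lintegral_map (f := fun j => blockWeight k (i, j)) (measurable_of_countable _) hidx]
    exact h₁ i
  have h₂' : ∀ j, ∫⁻ v, blockWeight k (idx v, j) ∂ρ ≤ 1 := fun j => by
    rw [← lintegral_map (f := fun i => blockWeight k (i, j)) (measurable_of_countable _) hidx]
    exact h₂ j
  rw [hprod, lintegral_map (measurable_of_countable _) hidx2] at h₃
  refine ⟨k, ⟨h₁', h₂'⟩, ?_⟩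
  refine (lintegral_withDensity_completedDensity_le (measurable_cellDensity hidx k)
    (fun v => h₁' (idx v)) (fun w => h₂' (idx w)) hc hM).trans ?_
  refine add_le_add ?_ (mul_le_mul_right h₃ M)
  -- The infimum of `c` over each product of cells is a cost on `ℕ × ℕ`.
  let c' : ℕ × ℕ → ℝ≥0∞ := fun i => ⨅ q, ⨅ _ : Prod.map idx idx q = i, c q
  have hc'_le : ∀ p, c' (Prod.map idx idx p) ≤ c p := fun p =>
    iInf₂_le (f := fun q (_ : Prod.map idx idx q = Prod.map idx idx p) => c q) p rfl
  have hle_c' : ∀ p, c p ≤ c' (Prod.map idx idx p) + δ := fun p =>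
    tsub_le_iff_right.1 <| le_iInf₂ fun q hq => tsub_le_iff_right.2 (hδ p q hq.symm)
  calc ∫⁻ p, c p * cellDensity idx k p ∂(ρ.prod η)
      ≤ ∫⁻ p, (c' (Prod.map idx idx p) + δ) * blockWeight k (Prod.map idx idx p) ∂(ρ.prod η) :=
        lintegral_mono fun p => mul_le_mul_left (hle_c' p) _
    _ = ∫⁻ i, (c' i + δ) * blockWeight k i ∂((ρ.map idx).prod (η.map idx)) := by
        rw [hprod, lintegral_map (measurable_of_countable _) hidx2]
    _ ≤ ∫⁻ i, (c' i + δ) ∂(γ.map (Prod.map idx idx)) := h₄ _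
    _ = ∫⁻ p, (c' (Prod.map idx idx p) + δ) ∂γ := lintegral_map (measurable_of_countable _) hidx2
    _ ≤ ∫⁻ p, (c p + δ) ∂γ := lintegral_mono fun p => add_le_add_left (hc'_le p) _
    _ = ∫⁻ p, c p ∂γ + δ := by rw [lintegral_add_right _ measurable_const]; simp [hγ1]

end Fibre

/-! ### Measurable selection of near-optimal plans -/

section Selection

variable {X V : Type*} [MeasurableSpace X] [MeasurableSpace V]

open Classical in
/-- The `k`-th candidate density at `x`: the completed block density when `k` is feasible for the
fibre measures at `x`, and the density of the independent plan otherwise. -/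
noncomputable def candidateDensity (κ η : Kernel X V) (idx : V → ℕ) (k : BlockIndex)
    (x : X) : V × V → ℝ≥0∞ :=
  if IsFeasible idx k (κ x) (η x) then completedDensity (κ x) (η x) (cellDensity idx k) else 1

variable {κ η : Kernel X V} [IsMarkovKernel κ] [IsMarkovKernel η] {idx : V → ℕ}

lemma measurable_uncurry_candidateDensity (hidx : Measurable idx) (k : BlockIndex) :
    Measurable (Function.uncurry (candidateDensity κ η idx k)) := by
  have hb : Measurable (blockWeight k) := measurable_of_countable _
  have hk := measurable_cellDensity hidx k
  have hF : MeasurableSet {x | IsFeasible idx k (κ x) (η x)} := by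
    simp only [IsFeasible, Set.ofPred_and, Set.ofPred_forall]
    refine MeasurableSet.inter (MeasurableSet.iInter fun i => ?_)
      (MeasurableSet.iInter fun j => ?_)
    · exact measurableSet_le
        (Measurable.lintegral_kernel (hb.comp (measurable_const.prodMk hidx))) measurable_const
    · exact measurableSet_le
        (Measurable.lintegral_kernel (hb.comp (hidx.prodMk measurable_const))) measurable_const
  have m₁ : Measurable fun q : X × V => ∫⁻ w, cellDensity idx k (q.2, w) ∂(η q.1) :=
    Measurable.lintegral_kernel_prod_right (κ := Kernel.prodMkRight V η)
      (f := fun q w => cellDensity idx k (q.2, w)) (by unfold Function.uncurry; fun_prop)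
  have m₂ : Measurable fun q : X × V => ∫⁻ v, cellDensity idx k (v, q.2) ∂(κ q.1) :=
    Measurable.lintegral_kernel_prod_right (κ := Kernel.prodMkRight V κ)
      (f := fun q v => cellDensity idx k (v, q.2)) (by unfold Function.uncurry; fun_prop)
  have m₃ : Measurable fun x : X => ∫⁻ p, cellDensity idx k p ∂((κ x).prod (η x)) := by
    simp_rw [← Kernel.prod_apply]
    exact hk.lintegral_kernel
  have : Function.uncurry (candidateDensity κ η idx k) = fun q : X × (V × V) =>
      open Classical in if q ∈ Prod.fst ⁻¹' {x | IsFeasible idx k (κ x) (η x)} then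
        cellDensity idx k q.2 + (1 - ∫⁻ w, cellDensity idx k (q.2.1, w) ∂(η q.1)) *
          (1 - ∫⁻ v, cellDensity idx k (v, q.2.2) ∂(κ q.1)) *
          (1 - ∫⁻ p, cellDensity idx k p ∂((κ q.1).prod (η q.1)))⁻¹
      else 1 := by
    ext ⟨x, p⟩
    by_cases h : IsFeasible idx k (κ x) (η x) <;>
      simp [Function.uncurry, candidateDensity, completedDensity, h]
  rw [this]
  refine Measurable.ite (measurable_fst hF) ?_ measurable_const
  have m₁' := m₁.comp (measurable_fst.prodMk (measurable_fst.comp measurable_snd) :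
    Measurable fun q : X × (V × V) => (q.1, q.2.1))
  have m₂' := m₂.comp (measurable_fst.prodMk (measurable_snd.comp measurable_snd) :
    Measurable fun q : X × (V × V) => (q.1, q.2.2))
  have m₃' := m₃.comp (measurable_fst : Measurable fun q : X × (V × V) => q.1)
  exact (hk.comp measurable_snd).add
    (((measurable_const.sub m₁').mul (measurable_const.sub m₂')).mul (measurable_const.sub m₃').inv)

/-- The `k`-th candidate plan at each `x`, as a kernel. -/
noncomputable def candidatePlan (κ η : Kernel X V) [IsMarkovKernel κ] [IsMarkovKernel η]
    (idx : V → ℕ) (k : BlockIndex) : Kernel X (V × V) :=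
  (κ ×ₖ η).withDensity (candidateDensity κ η idx k)

lemma candidatePlan_apply (hidx : Measurable idx) (k : BlockIndex) (x : X) :
    candidatePlan κ η idx k x = ((κ x).prod (η x)).withDensity (candidateDensity κ η idx k x) := by
  rw [candidatePlan, Kernel.withDensity_apply _ (measurable_uncurry_candidateDensity hidx k),
    Kernel.prod_apply]

lemma candidatePlan_mem_transportPlans (hidx : Measurable idx) (k : BlockIndex) (x : X) :
    candidatePlan κ η idx k x ∈ transportPlans (κ x) (η x) := by
  rw [candidatePlan_apply hidx, candidateDensity]
  split_ifs with h
  · exact withDensity_completedDensity_mem_transportPlans (measurable_cellDensity hidx k)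
      (fun v => h.1 (idx v)) (fun w => h.2 (idx w))
  · exact withDensity_prod_mem_transportPlans measurable_one (by simp) (by simp)

/-- A countable family of kernels whose cost comes arbitrarily close to `h` at every point contains
a measurable selection that is `ε`-close to `h` at every point. -/
lemma exists_kernel_selection {Y ι : Type*} [MeasurableSpace Y] [Countable ι] [Nonempty ι]
    (σ : ι → Kernel X Y) {c : Y → ℝ≥0∞} (hc : Measurable c) {h : X → ℝ≥0∞} (hh : ∀ x, h x ≠ ∞)
    (hσ : ∀ x, ⨅ k, ∫⁻ y, c y ∂(σ k x) ≤ h x) {ε : ℝ≥0∞} (hε : ε ≠ 0) :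
    ∃ τ : Kernel X Y, (∀ x, ∃ k, τ x = σ k x) ∧ ∀ x, ∫⁻ y, c y ∂(τ x) ≤ h x + ε := by
  classical
  obtain ⟨e, he⟩ := exists_surjective_nat ι
  have hm : ∀ k, Measurable fun x => ∫⁻ y, c y ∂(σ k x) := fun k => hc.lintegral_kernel
  have hex : ∀ x, ∃ n, ∫⁻ y, c y ∂(σ (e n) x) ≤ (⨅ k, ∫⁻ y, c y ∂(σ k x)) + ε := fun x => by
    have hlt : ⨅ k, ∫⁻ y, c y ∂(σ k x) < (⨅ k, ∫⁻ y, c y ∂(σ k x)) + ε :=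
      ENNReal.lt_add_right ((hσ x).trans_lt (hh x).lt_top).ne hε
    obtain ⟨k, hk⟩ := iInf_lt_iff.1 hlt
    obtain ⟨n, rfl⟩ := he k
    exact ⟨n, hk.le⟩
  have hfind : Measurable fun x => Nat.find (hex x) :=
    measurable_find _ fun n => measurableSet_le (hm _) ((Measurable.iInf hm).add measurable_const)
  have hpair : Measurable fun q : ℕ × X => σ (e q.1) q.2 :=
    measurable_from_prod_countable_right fun n => (σ (e n)).measurable
  refine ⟨⟨fun x => σ (e (Nat.find (hex x))) x, hpair.comp (hfind.prodMk measurable_id)⟩,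
    fun x => ⟨_, rfl⟩, fun x => (Nat.find_spec (hex x)).trans (by gcongr; exact hσ x)⟩

/-- Near-optimal plans between the fibres of two Markov kernels can be chosen measurably. -/
lemma exists_kernel_transportPlans {c : V × V → ℝ≥0∞} (hc : Measurable c) {M : ℝ≥0∞}
    (hM : ∀ p, c p ≤ M) (hMtop : M ≠ ∞)
    (hosc : ∀ δ : ℝ≥0∞, δ ≠ 0 → ∃ idx : V → ℕ, Measurable idx ∧
      ∀ p q, Prod.map idx idx p = Prod.map idx idx q → c p ≤ c q + δ)
    {ε : ℝ≥0∞} (hε : ε ≠ 0) (hεtop : ε ≠ ∞) :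
    ∃ τ : Kernel X (V × V), (∀ x, τ x ∈ transportPlans (κ x) (η x)) ∧
      ∀ x, ∫⁻ p, c p ∂(τ x) ≤ (⨅ γ ∈ transportPlans (κ x) (η x), ∫⁻ p, c p ∂γ) + ε := by
  have hε2 : ε / 2 ≠ 0 := by simpa using hε
  obtain ⟨idx, hidx, hidxc⟩ := hosc (ε / 2) hε2
  let h : X → ℝ≥0∞ := fun x => ⨅ γ ∈ transportPlans (κ x) (η x), ∫⁻ p, c p ∂γ
  have hfin : ∀ x, h x ≠ ∞ := fun x => by
    refine ne_top_of_le_ne_top hMtop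
      ((iInf₂_le _ (candidatePlan_mem_transportPlans hidx (0, 0) x)).trans ?_)
    refine (lintegral_mono hM).trans ?_
    rw [lintegral_const, ← Measure.fst_univ, (candidatePlan_mem_transportPlans hidx (0, 0) x).1,
      measure_univ, mul_one]
  have hinf : ∀ x, ⨅ k, ∫⁻ p, c p ∂(candidatePlan κ η idx k x) ≤ h x + ε / 2 := fun x => by
    rw [← tsub_le_iff_right]
    refine le_iInf₂ fun γ hγ => tsub_le_iff_right.2 ?_
    refine ENNReal.le_of_forall_pos_le_add fun ζ hζ _ => ?_
    have hζ' : (ζ : ℝ≥0∞) / (M + 1) ≠ 0 := by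
      refine (ENNReal.div_pos (by exact_mod_cast hζ.ne') (by finiteness)).ne'
    obtain ⟨k, hk, hkc⟩ := exists_isFeasible_lintegral_le hidx hc hM hidxc hγ hζ'
    refine (iInf_le _ k).trans ?_
    rw [candidatePlan_apply hidx, candidateDensity, if_pos hk]
    refine hkc.trans ?_
    gcongr
    calc M * (ζ / (M + 1)) ≤ (M + 1) * (ζ / (M + 1)) := by gcongr; exact le_self_add
      _ ≤ ζ := ENNReal.mul_div_le
  obtain ⟨τ, hτ, hτc⟩ := exists_kernel_selection (candidatePlan κ η idx) hc
    (h := fun x => h x + ε / 2)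
    (fun x => ENNReal.add_ne_top.2 ⟨hfin x, ENNReal.div_ne_top hεtop two_ne_zero⟩) hinf hε2
  refine ⟨τ, fun x => ?_, fun x => (hτc x).trans ?_⟩
  · obtain ⟨k, hk⟩ := hτ x
    exact hk ▸ candidatePlan_mem_transportPlans hidx k x
  · rw [add_assoc, ENNReal.add_halves]

end Selection

/-! ### Plans over the common base space -/

section FiberedPlans

variable {X V : Type*} [MeasurableSpace X] [MeasurableSpace V]

/-- Measures on `X × V × V` whose `(x, v)`-marginal is `μ` and whose `(x, w)`-marginal is `ν`:
transport plans from `μ` to `ν` that do not move the `x`-coordinate. -/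
def fiberedPlans (μ ν : Measure (X × V)) : Set (Measure (X × V × V)) :=
  {γ | γ.map (Prod.map id Prod.fst) = μ ∧ γ.map (Prod.map id Prod.snd) = ν}

lemma fst_eq_of_mem_fiberedPlans {μ ν : Measure (X × V)} {γ : Measure (X × V × V)}
    (hγ : γ ∈ fiberedPlans μ ν) : μ.fst = γ.fst ∧ ν.fst = γ.fst := by
  rw [← hγ.1, ← hγ.2]
  constructor <;>
  · rw [Measure.fst, Measure.map_map measurable_fst (by fun_prop)]
    rfl

lemma compProd_mem_fiberedPlans [StandardBorelSpace V] [Nonempty V] {μ ν : Measure (X × V)}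
    [IsFiniteMeasure μ] [IsFiniteMeasure ν] (h : μ.fst = ν.fst) {τ : Kernel X (V × V)}
    [IsMarkovKernel τ] (hτ : ∀ x, τ x ∈ transportPlans (μ.condKernel x) (ν.condKernel x)) :
    μ.fst ⊗ₘ τ ∈ fiberedPlans μ ν := by
  have h₁ : τ.map Prod.fst = μ.condKernel := by
    ext1 x
    rw [Kernel.map_apply _ measurable_fst, ← (hτ x).1, Measure.fst]
  have h₂ : τ.map Prod.snd = ν.condKernel := by
    ext1 x
    rw [Kernel.map_apply _ measurable_snd, ← (hτ x).2, Measure.snd]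
  constructor
  · rw [← Measure.compProd_map measurable_fst, h₁, Measure.disintegrate]
  · rw [← Measure.compProd_map measurable_snd, h₂, h, Measure.disintegrate]

/-- The fibres of a fibered plan are plans between the fibres, by uniqueness of disintegrations. -/
lemma condKernel_mem_transportPlans [StandardBorelSpace V] [Nonempty V] {μ ν : Measure (X × V)}
    [IsFiniteMeasure μ] [IsFiniteMeasure ν] {γ : Measure (X × V × V)} [IsFiniteMeasure γ]
    (hγ : γ ∈ fiberedPlans μ ν) :
    ∀ᵐ x ∂γ.fst, γ.condKernel x ∈ transportPlans (μ.condKernel x) (ν.condKernel x) := by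
  obtain ⟨h₁, h₂⟩ := fst_eq_of_mem_fiberedPlans hγ
  have e₁ : μ = μ.fst ⊗ₘ γ.condKernel.map Prod.fst := by
    rw [Measure.compProd_map measurable_fst, h₁, Measure.disintegrate, hγ.1]
  have e₂ : ν = ν.fst ⊗ₘ γ.condKernel.map Prod.snd := by
    rw [Measure.compProd_map measurable_snd, h₂, Measure.disintegrate, hγ.2]
  have k₁ := eq_condKernel_of_measure_eq_compProd _ e₁
  have k₂ := eq_condKernel_of_measure_eq_compProd _ e₂
  rw [h₁] at k₁
  rw [h₂] at k₂
  filter_upwards [k₁, k₂] with x hx₁ hx₂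
  rw [Kernel.map_apply _ measurable_fst] at hx₁
  rw [Kernel.map_apply _ measurable_snd] at hx₂
  exact ⟨hx₁, hx₂⟩

lemma lintegral_iInf_transportPlans_le [StandardBorelSpace V] [Nonempty V] {μ ν : Measure (X × V)}
    [IsFiniteMeasure μ] [IsFiniteMeasure ν] {γ : Measure (X × V × V)} [IsFiniteMeasure γ]
    (hγ : γ ∈ fiberedPlans μ ν) {c : V × V → ℝ≥0∞} (hc : Measurable c) :
    ∫⁻ x, ⨅ σ ∈ transportPlans (μ.condKernel x) (ν.condKernel x), ∫⁻ p, c p ∂σ ∂μ.fst ≤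
      ∫⁻ z, c z.2 ∂γ := by
  rw [(fst_eq_of_mem_fiberedPlans hγ).1]
  conv_rhs => rw [← γ.disintegrate γ.condKernel, Measure.lintegral_compProd (by fun_prop)]
  refine lintegral_mono_ae ?_
  filter_upwards [condKernel_mem_transportPlans hγ] with x hx
  exact iInf₂_le _ hx

/-- Fibrewise near-optimal plans glue to a fibered plan. The integrand on the right need not be
known to be measurable: it is bounded below, up to `ε`, by the measurable fibre cost of the plan. -/
lemma exists_mem_fiberedPlans_lintegral_le [StandardBorelSpace V] [Nonempty V]
    {μ ν : Measure (X × V)} [IsProbabilityMeasure μ] [IsProbabilityMeasure ν] (h : μ.fst = ν.fst)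
    {c : V × V → ℝ≥0∞} (hc : Measurable c) {M : ℝ≥0∞} (hM : ∀ p, c p ≤ M) (hMtop : M ≠ ∞)
    (hosc : ∀ δ : ℝ≥0∞, δ ≠ 0 → ∃ idx : V → ℕ, Measurable idx ∧
      ∀ p q, Prod.map idx idx p = Prod.map idx idx q → c p ≤ c q + δ)
    {ε : ℝ≥0∞} (hε : ε ≠ 0) (hεtop : ε ≠ ∞) :
    ∃ γ ∈ fiberedPlans μ ν, IsProbabilityMeasure γ ∧ ∫⁻ z, c z.2 ∂γ ≤
      ∫⁻ x, ⨅ σ ∈ transportPlans (μ.condKernel x) (ν.condKernel x), ∫⁻ p, c p ∂σ ∂μ.fst + ε := by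
  obtain ⟨τ, hτ, hτc⟩ := exists_kernel_transportPlans (κ := μ.condKernel) (η := ν.condKernel)
    hc hM hMtop hosc hε hεtop
  have : IsMarkovKernel τ := ⟨fun x => ⟨by rw [← Measure.fst_univ, (hτ x).1, measure_univ]⟩⟩
  refine ⟨_, compProd_mem_fiberedPlans h hτ, inferInstance, ?_⟩
  rw [Measure.lintegral_compProd (by fun_prop)]
  refine (lintegral_mono hτc).trans ?_
  rw [lintegral_add_right _ measurable_const]
  simp

end FiberedPlans

/-! ### Compactness of fibered plans -/

section Compactness

variable {X V : Type*} [MetricSpace X] [SecondCountableTopology X] [CompleteSpace X]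
  [MeasurableSpace X] [BorelSpace X] [MetricSpace V] [SecondCountableTopology V]
  [CompleteSpace V] [MeasurableSpace V] [BorelSpace V]

/-- Fibered plans between the terms of two narrowly convergent sequences have a subsequence that
converges narrowly to a fibered plan between the limits. -/
lemma exists_subseq_tendsto_mem_fiberedPlans {μs νs : ℕ → ProbabilityMeasure (X × V)}
    {μ ν : ProbabilityMeasure (X × V)} (hμ : Tendsto μs atTop (𝓝 μ)) (hν : Tendsto νs atTop (𝓝 ν))
    {γs : ℕ → ProbabilityMeasure (X × V × V)}
    (hγ : ∀ n, (γs n : Measure (X × V × V)) ∈ fiberedPlans (μs n : Measure (X × V)) (νs n)) :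
    ∃ γ : ProbabilityMeasure (X × V × V),
      (γ : Measure (X × V × V)) ∈ fiberedPlans (μ : Measure (X × V)) ν ∧
      ∃ φ : ℕ → ℕ, StrictMono φ ∧ Tendsto (γs ∘ φ) atTop (𝓝 γ) := by
  have tight : ∀ {ρs : ℕ → ProbabilityMeasure (X × V)} {ρ : ProbabilityMeasure (X × V)},
      Tendsto ρs atTop (𝓝 ρ) →
      IsTightMeasureSet {m | ∃ ρ' ∈ Set.range ρs, (ρ' : Measure (X × V)) = m} := fun {ρs ρ} h =>
    isTightMeasureSet_of_isCompact_closure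
      (h.isCompact_insert_range.closure_of_subset (Set.subset_insert _ _))
  have c₁ : Continuous (Prod.map id Prod.fst : X × V × V → X × V) := by fun_prop
  have c₂ : Continuous (Prod.map id Prod.snd : X × V × V → X × V) := by fun_prop
  have hmap₁ : ∀ n, (γs n).map c₁.measurable.aemeasurable = μs n := fun n =>
    Subtype.ext (hγ n).1
  have hmap₂ : ∀ n, (γs n).map c₂.measurable.aemeasurable = νs n := fun n =>
    Subtype.ext (hγ n).2
  have htight : IsTightMeasureSet {m | ∃ γ' ∈ Set.range γs, (γ' : Measure (X × V × V)) = m} := by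
    refine IsTightMeasureSet.prodMk (((tight hμ).map continuous_fst).subset ?_)
      (IsTightMeasureSet.prodMk (((tight hμ).map continuous_snd).subset ?_)
        (((tight hν).map continuous_snd).subset ?_))
    · rintro _ ⟨_, ⟨_, ⟨n, rfl⟩, rfl⟩, rfl⟩
      refine ⟨_, ⟨_, ⟨n, rfl⟩, rfl⟩, ?_⟩
      exact (fst_eq_of_mem_fiberedPlans (hγ n)).1
    · rintro _ ⟨_, ⟨_, ⟨_, ⟨n, rfl⟩, rfl⟩, rfl⟩, rfl⟩
      refine ⟨_, ⟨_, ⟨n, rfl⟩, rfl⟩, ?_⟩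
      rw [← (hγ n).1, Measure.map_map measurable_snd c₁.measurable, Measure.fst, Measure.snd,
        Measure.map_map measurable_fst measurable_snd]
      rfl
    · rintro _ ⟨_, ⟨_, ⟨_, ⟨n, rfl⟩, rfl⟩, rfl⟩, rfl⟩
      refine ⟨_, ⟨_, ⟨n, rfl⟩, rfl⟩, ?_⟩
      rw [← (hγ n).2, Measure.map_map measurable_snd c₂.measurable, Measure.snd, Measure.snd,
        Measure.map_map measurable_snd measurable_snd]
      rfl
  obtain ⟨γ, -, φ, hφ, hlim⟩ := (isCompact_closure_of_isTightMeasureSet htight).isSeqCompact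
    (fun n => subset_closure (Set.mem_range_self n))
  refine ⟨γ, ⟨?_, ?_⟩, φ, hφ, hlim⟩
  · have h₁ := ProbabilityMeasure.tendsto_map_of_tendsto_of_continuous _ _ hlim c₁
    simp only [Function.comp_apply, hmap₁] at h₁
    exact congrArg (fun m : ProbabilityMeasure (X × V) => (m : Measure (X × V)))
      (tendsto_nhds_unique h₁ (hμ.comp hφ.tendsto_atTop))
  · have h₂ := ProbabilityMeasure.tendsto_map_of_tendsto_of_continuous _ _ hlim c₂
    simp only [Function.comp_apply, hmap₂] at h₂
    exact congrArg (fun m : ProbabilityMeasure (X × V) => (m : Measure (X × V)))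
      (tendsto_nhds_unique h₂ (hν.comp hφ.tendsto_atTop))

end Compactness

/-! ### The truncated quadratic cost -/

section TruncatedCost

variable {V : Type*} [NormedAddCommGroup V]

/-- The quadratic cost `|v - w|²` with the distance cut off at `n`. -/
noncomputable def truncatedCost (n : ℕ) (p : V × V) : ℝ≥0 := (min ‖p.1 - p.2‖₊ n) ^ 2

lemma continuous_truncatedCost (n : ℕ) : Continuous (truncatedCost n : V × V → ℝ≥0) := by
  unfold truncatedCost
  fun_prop

lemma truncatedCost_le (n : ℕ) (p : V × V) : truncatedCost n p ≤ (n : ℝ≥0) ^ 2 :=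
  pow_le_pow_left₀ zero_le (min_le_right _ _) 2

lemma monotone_truncatedCost (p : V × V) : Monotone fun n => truncatedCost n p := fun m n h => by
  simp only [truncatedCost]
  gcongr

lemma truncatedCost_le_enorm (n : ℕ) (p : V × V) :
    (truncatedCost n p : ℝ≥0∞) ≤ ‖p.1 - p.2‖ₑ ^ 2 := by
  rw [enorm_eq_nnnorm, ← ENNReal.coe_pow, ENNReal.coe_le_coe]
  exact pow_le_pow_left₀ zero_le (min_le_left _ _) 2

lemma iSup_truncatedCost (p : V × V) :
    ⨆ n, (truncatedCost n p : ℝ≥0∞) = ‖p.1 - p.2‖ₑ ^ 2 := by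
  refine le_antisymm (iSup_le fun n => truncatedCost_le_enorm n p) ?_
  obtain ⟨n, hn⟩ := exists_nat_ge ‖p.1 - p.2‖₊
  refine le_iSup_of_le n ?_
  rw [truncatedCost, min_eq_left hn, ENNReal.coe_pow, enorm_eq_nnnorm]

/-- The truncated cost oscillates little on products of small cells. -/
lemma exists_idx_truncatedCost_le [SecondCountableTopology V] [MeasurableSpace V]
    [OpensMeasurableSpace V] (n : ℕ) {δ : ℝ≥0∞} (hδ : δ ≠ 0) :
    ∃ idx : V → ℕ, Measurable idx ∧ ∀ p q : V × V, Prod.map idx idx p = Prod.map idx idx q →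
      (truncatedCost n p : ℝ≥0∞) ≤ truncatedCost n q + δ := by
  obtain ⟨δ', hδ'0, hδ'⟩ := ENNReal.lt_iff_exists_nnreal_btwn.1 (pos_iff_ne_zero.2 hδ)
  have hpos : (0 : ℝ) < δ' := by exact_mod_cast hδ'0
  obtain ⟨A, hAm, hAb, hAd, hAU, hAdisj⟩ :=
    SeparableSpace.exists_measurable_partition_diam_le V (ε := δ' / (4 * n + 1)) (by positivity)
  have hex : ∀ v, ∃ i, v ∈ A i := fun v => Set.mem_iUnion.1 (hAU ▸ Set.mem_univ v)
  classical
  refine ⟨fun v => Nat.find (hex v), measurable_find _ hAm, fun p q hpq => ?_⟩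
  refine le_trans ?_ (add_le_add_right hδ'.le _)
  have hd : ∀ {v w : V}, Nat.find (hex v) = Nat.find (hex w) → dist v w ≤ δ' / (4 * n + 1) :=
    fun {v w} h => (Metric.dist_le_diam_of_mem (hAb _) (Nat.find_spec (hex v))
      (h ▸ Nat.find_spec (hex w))).trans (hAd _)
  have h₁ := hd (congrArg Prod.fst hpq)
  have h₂ := hd (congrArg Prod.snd hpq)
  have hn : ‖p.1 - p.2‖ ≤ ‖q.1 - q.2‖ + 2 * (δ' / (4 * n + 1)) := by
    rw [← dist_eq_norm, ← dist_eq_norm]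
    linarith [dist_triangle4 p.1 q.1 q.2 p.2, dist_comm p.2 q.2]
  rw [← ENNReal.coe_add, ENNReal.coe_le_coe, ← NNReal.coe_le_coe]
  simp only [truncatedCost, NNReal.coe_add, NNReal.coe_pow, NNReal.coe_min, coe_nnnorm,
    NNReal.coe_natCast]
  set e : ℝ := δ' / (4 * n + 1) with he
  have he0 : 0 ≤ e := by positivity
  have hee : 4 * n * e ≤ δ' := by
    have : (4 * n + 1) * e = δ' := by rw [he]; field_simp
    linarith
  -- With `s ≤ t + 2e` and `s, t ≤ n` one has `s² - t² = (s - t) (s + t) ≤ 4 n e`.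
  have hs : min ‖p.1 - p.2‖ (n : ℝ) ≤ min ‖q.1 - q.2‖ (n : ℝ) + 2 * e := by
    rw [← min_add_add_right]
    exact min_le_min hn (by linarith)
  have hs0 : 0 ≤ min ‖p.1 - p.2‖ (n : ℝ) := by positivity
  have ht0 : 0 ≤ min ‖q.1 - q.2‖ (n : ℝ) := by positivity
  have hsn := min_le_right ‖p.1 - p.2‖ (n : ℝ)
  have htn := min_le_right ‖q.1 - q.2‖ (n : ℝ)
  nlinarith [mul_le_mul_of_nonneg_right hs (add_nonneg hs0 ht0)]

lemma tendsto_lintegral_truncatedCost [MeasurableSpace V] [BorelSpace V]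
    [SecondCountableTopology V] {X : Type*} [TopologicalSpace X] [MeasurableSpace X]
    [OpensMeasurableSpace (X × V × V)] {γs : ℕ → ProbabilityMeasure (X × V × V)}
    {γ : ProbabilityMeasure (X × V × V)} (h : Tendsto γs atTop (𝓝 γ)) (m : ℕ) :
    Tendsto (fun n => ∫⁻ z, truncatedCost m z.2 ∂(γs n : Measure (X × V × V))) atTop
      (𝓝 (∫⁻ z, truncatedCost m z.2 ∂(γ : Measure (X × V × V)))) :=
  ProbabilityMeasure.tendsto_iff_forall_lintegral_tendsto.1 h
    (BoundedContinuousFunction.mkOfBound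
      ⟨fun z => truncatedCost m z.2, (continuous_truncatedCost m).comp continuous_snd⟩
      ((m : ℝ≥0) ^ 2 : ℝ≥0) fun _ _ => abs_sub_le_of_nonneg_of_le (NNReal.coe_nonneg _)
        (NNReal.coe_le_coe.2 (truncatedCost_le m _)) (NNReal.coe_nonneg _)
        (NNReal.coe_le_coe.2 (truncatedCost_le m _)))

lemma lintegral_enorm_sub_sq_le [MeasurableSpace V] [BorelSpace V] [SecondCountableTopology V]
    {X : Type*} [MeasurableSpace X] {γ : Measure (X × V × V)} {C : ℝ≥0∞}
    (h : ∀ m, ∫⁻ z, truncatedCost m z.2 ∂γ ≤ C) : ∫⁻ z, ‖z.2.1 - z.2.2‖ₑ ^ 2 ∂γ ≤ C := by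
  have hm : ∀ m, Measurable fun z : X × V × V => (truncatedCost m z.2 : ℝ≥0∞) := fun m =>
    ((continuous_truncatedCost m).measurable.comp measurable_snd).coe_nnreal_ennreal
  simp_rw [← iSup_truncatedCost]
  rw [lintegral_iSup hm fun m n hmn z => ENNReal.coe_le_coe.2 (monotone_truncatedCost z.2 hmn)]
  exact iSup_le h

end TruncatedCost

/-! ### Lower semicontinuity -/

lemma W2_sq {d : ℕ} (μ ν : Measure (EuclideanSpace ℝ (Fin d))) :
    W2 μ ν ^ 2 = ⨅ γ ∈ transportPlans μ ν, ∫⁻ p, ‖p.1 - p.2‖ₑ ^ 2 ∂γ := by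
  rw [W2, ← ENNReal.rpow_natCast, ← ENNReal.rpow_mul]
  norm_num

lemma W2v_sq {d : ℕ} {μ ν : P2 d} (h : μ.toMeasure.fst = ν.toMeasure.fst) :
    W2v μ ν ^ 2 = ∫⁻ x, ⨅ γ ∈ transportPlans (μ.toMeasure.condKernel x) (ν.toMeasure.condKernel x),
      ∫⁻ p, ‖p.1 - p.2‖ₑ ^ 2 ∂γ ∂μ.toMeasure.fst := by
  rw [W2v, if_pos (show μ.xMarginal = ν.xMarginal from h), ← ENNReal.rpow_natCast,
    ← ENNReal.rpow_mul]
  norm_num [P2.disintegration, P2.xMarginal, W2_sq]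

lemma W2v_sq_le_of_mem_fiberedPlans {d : ℕ} {μ ν : P2 d}
    {γ : ProbabilityMeasure (EuclideanSpace ℝ (Fin d) × EuclideanSpace ℝ (Fin d) ×
      EuclideanSpace ℝ (Fin d))} (hγ : γ.toMeasure ∈ fiberedPlans μ.toMeasure ν.toMeasure) :
    W2v μ ν ^ 2 ≤ ∫⁻ z, ‖z.2.1 - z.2.2‖ₑ ^ 2 ∂γ.toMeasure := by
  obtain ⟨h₁, h₂⟩ := fst_eq_of_mem_fiberedPlans hγ
  rw [W2v_sq (h₁.trans h₂.symm)]
  exact lintegral_iInf_transportPlans_le hγ (c := fun p => ‖p.1 - p.2‖ₑ ^ 2) (by fun_prop)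

lemma exists_mem_fiberedPlans_truncatedCost_le {d : ℕ} {μ ν : P2 d} (h : W2v μ ν ≠ ∞) (n : ℕ)
    {ε : ℝ≥0∞} (hε : ε ≠ 0) (hεtop : ε ≠ ∞) :
    ∃ γ : ProbabilityMeasure (EuclideanSpace ℝ (Fin d) × EuclideanSpace ℝ (Fin d) ×
        EuclideanSpace ℝ (Fin d)), γ.toMeasure ∈ fiberedPlans μ.toMeasure ν.toMeasure ∧
      ∫⁻ z, truncatedCost n z.2 ∂γ.toMeasure ≤ W2v μ ν ^ 2 + ε := by
  have hfst : μ.toMeasure.fst = ν.toMeasure.fst := by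
    by_contra hne
    exact h (if_neg hne)
  obtain ⟨γ, hγ, hprob, hle⟩ := exists_mem_fiberedPlans_lintegral_le hfst
    (c := fun p => (truncatedCost n p : ℝ≥0∞)) (M := ((n : ℝ≥0) ^ 2 : ℝ≥0))
    (continuous_truncatedCost n).measurable.coe_nnreal_ennreal
    (fun p => ENNReal.coe_le_coe.2 (truncatedCost_le n p)) ENNReal.coe_ne_top
    (fun δ hδ => exists_idx_truncatedCost_le n hδ) hε hεtop
  refine ⟨⟨γ, hprob⟩, hγ, hle.trans ?_⟩
  rw [W2v_sq hfst]
  gcongr with x σ hσ p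
  exact truncatedCost_le_enorm n p

theorem mainTheorem9 (d : ℕ) :
    LowerSemicontinuous (fun p : P2 d × P2 d => W2v p.1 p.2) := by
  rintro ⟨μ, ν⟩ y hy
  by_contra hcon
  have : FirstCountableTopology (P2 d) := IsInducing.subtypeVal.firstCountableTopology
  obtain ⟨u, hu, huy⟩ := exists_seq_forall_of_frequently (not_eventually.1 hcon)
  simp only [not_lt] at hy huy
  have hfin : ∀ n, W2v (u n).1 (u n).2 ≠ ∞ := fun n => ((huy n).trans_lt (hy.trans_le le_top)).ne
  have hε : ∀ n : ℕ, ((n : ℝ≥0∞) + 1)⁻¹ ≠ 0 := fun n => by simp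
  choose γs hγs hcost using fun n =>
    exists_mem_fiberedPlans_truncatedCost_le (hfin n) n (hε n) (by simp)
  have hμ : Tendsto (fun n => (u n).1.1) atTop (𝓝 μ.1) :=
    (continuous_subtype_val.comp continuous_fst).continuousAt.tendsto.comp hu
  have hν : Tendsto (fun n => (u n).2.1) atTop (𝓝 ν.1) :=
    (continuous_subtype_val.comp continuous_snd).continuousAt.tendsto.comp hu
  obtain ⟨γ, hγ, φ, hφ, hlim⟩ := exists_subseq_tendsto_mem_fiberedPlans hμ hν hγs
  have hε0 : Tendsto (fun n : ℕ => ((n : ℝ≥0∞) + 1)⁻¹) atTop (𝓝 0) := by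
    simpa using (tendsto_add_atTop_iff_nat 1).2 ENNReal.tendsto_inv_nat_nhds_zero
  -- For a fixed truncation level `m`, the plans of index at least `m` are near-optimal for a cost
  -- that dominates the one truncated at `m`.
  have htrunc : ∀ m, ∫⁻ z, truncatedCost m z.2 ∂γ.toMeasure ≤ y ^ 2 := fun m => by
    have hbound : Tendsto (fun n => y ^ 2 + ((φ n : ℝ≥0∞) + 1)⁻¹) atTop (𝓝 (y ^ 2 + 0)) :=
      tendsto_const_nhds.add (hε0.comp hφ.tendsto_atTop)
    rw [add_zero] at hbound
    refine le_of_tendsto_of_tendsto (tendsto_lintegral_truncatedCost hlim m) hbound ?_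
    filter_upwards [eventually_ge_atTop m] with n hn
    calc ∫⁻ z, truncatedCost m z.2 ∂(γs (φ n)).toMeasure
        ≤ ∫⁻ z, truncatedCost (φ n) z.2 ∂(γs (φ n)).toMeasure :=
          lintegral_mono fun z => ENNReal.coe_le_coe.2
            (monotone_truncatedCost z.2 (hn.trans (hφ.le_apply)))
      _ ≤ W2v (u (φ n)).1 (u (φ n)).2 ^ 2 + ((φ n : ℝ≥0∞) + 1)⁻¹ := hcost _
      _ ≤ y ^ 2 + ((φ n : ℝ≥0∞) + 1)⁻¹ := by gcongr; exact huy _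
  have hle : W2v μ ν ^ 2 ≤ y ^ 2 :=
    (W2v_sq_le_of_mem_fiberedPlans hγ).trans (lintegral_enorm_sub_sq_le htrunc)
  exact absurd hy (not_lt.2 ((ENNReal.pow_le_pow_left_iff two_ne_zero).1 hle))
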